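/- Let $d \ge 2$ be an integer and let $G \in \mathbb{C}^{d\times d}$ be a complex Ginibre matrix, i.e. a random matrix whose entries are mutually independent standard complex Gaussian random variables with mean zero and unit variance (the real and imaginary parts of each entry are independent real Gaussians with mean $0$ and variance $1/2$). Let $L := G/\|G\|_2$, where $\|X\|_2 = (\operatorname{Tr}[XX^\dagger])^{1/2}$ is the Schatten $2$-norm (Frobenius norm), and let $\|\cdot\|_\infty$ denote the operator norm on $\mathbb{C}^d$ with its Euclidean norm. Then, for every $\delta \in (0,1)$, with probability at least $1-\delta$, $$\|L\|_\infty^2 \le \frac{16}{d} + \frac{8\log(2/\delta)}{d^2},$$ where $\log$ is the natural logarithm. -/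

import Mathlib

open MeasureTheory ProbabilityTheory
open scoped Matrix

noncomputable section

/-- The standard (circularly symmetric) complex Gaussian law with mean zero and unit variance on
`ℂ`: the real and the imaginary part are independent real Gaussians of mean `0` and
variance `1 / 2`. -/
def stdComplexGaussian : Measure ℂ :=
  ((gaussianReal 0 (1 / 2)).prod (gaussianReal 0 (1 / 2))).map
    (fun p : ℝ × ℝ => (⟨p.1, p.2⟩ : ℂ))

/-- `G` is a `d × d` complex Ginibre matrix on the probability space `(Ω, μ)`: its entries are
mutually independent standard complex Gaussian random variables. -/
structure IsComplexGinibre {Ω : Type*} [MeasurableSpace Ω] {d : ℕ}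
    (G : Ω → Matrix (Fin d) (Fin d) ℂ) (μ : Measure Ω) : Prop where
  /-- every entry has the standard complex Gaussian law -/
  hasLaw : ∀ i j, HasLaw (fun ω => G ω i j) stdComplexGaussian μ
  /-- the entries are mutually independent -/
  indep : iIndepFun (fun (p : Fin d × Fin d) ω => G ω p.1 p.2) μ

/-- The Schatten `2`-norm (Frobenius norm) `(Tr[X X†])^(1/2)`; the trace is a nonnegative real. -/
def schattenTwoNorm {d : ℕ} (X : Matrix (Fin d) (Fin d) ℂ) : ℝ :=
  Real.sqrt (X * Xᴴ).trace.re

/-- The operator norm of `X` on the Hilbert space `ℂ^d`. -/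
def operatorNorm {d : ℕ} (X : Matrix (Fin d) (Fin d) ℂ) : ℝ :=
  ‖Matrix.toEuclideanCLM (n := Fin d) (𝕜 := ℂ) X‖

/-- The Frobenius-normalized matrix `X / ‖X‖₂`. -/
def frobeniusNormalize {d : ℕ} (X : Matrix (Fin d) (Fin d) ℂ) : Matrix (Fin d) (Fin d) ℂ :=
  ((schattenTwoNorm X : ℂ)⁻¹) • X

end

-- A net argument reduces the operator norm to `‖G y‖` for at most `5 ^ (2 * d)` unit vectors `y`:
-- if `‖L‖² > T`, then some net point has `‖G y‖² ≥ (49/64) T ‖G‖₂²`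
-- (`exists_mem_net_of_lt_operatorNorm`). For fixed `y` this event is bounded by one Chernoff
-- estimate on the difference `‖G y‖² - t ‖G‖₂²`, so numerator and denominator need no separate
-- concentration bounds (`IsComplexGinibre.measure_le`). Its exponential moment is an exact Gaussian
-- integral (`lintegral_exp_norm_mulVec_sq_sub`). The union bound then closes by arithmetic
-- (`net_mul_tail_le`) when `T ≤ 1`; otherwise `‖L‖ ≤ 1` suffices.

-- Gaussian integrals

theorem lintegral_exp_quadratic_gaussianReal (b s : ℝ) (hs : 0 < 1 + s) :
    ∫⁻ x, ENNReal.ofReal (Real.exp (2 * b * x - s * x ^ 2)) ∂gaussianReal 0 (1 / 2) =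
      ENNReal.ofReal ((√(1 + s))⁻¹ * Real.exp (b ^ 2 / (1 + s))) := by
  obtain ⟨v, hv⟩ : ∃ v : NNReal, (v : ℝ) = 1 / (2 * (1 + s)) :=
    ⟨⟨1 / (2 * (1 + s)), by positivity⟩, rfl⟩
  have hv0 : v ≠ 0 := by
    intro h
    rw [h] at hv
    have : 0 < 1 / (2 * (1 + s)) := by positivity
    simp only [NNReal.coe_zero] at hv
    linarith
  rw [gaussianReal_of_var_ne_zero _ (by norm_num),
    lintegral_withDensity_eq_lintegral_mul _ (measurable_gaussianPDF _ _) (by fun_prop)]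
  have key : ∀ x, (gaussianPDF 0 (1 / 2) *
      fun x => ENNReal.ofReal (Real.exp (2 * b * x - s * x ^ 2))) x =
      ENNReal.ofReal ((√(1 + s))⁻¹ * Real.exp (b ^ 2 / (1 + s))) *
        gaussianPDF (b / (1 + s)) v x := by
    intro x
    simp only [Pi.mul_apply, gaussianPDF, gaussianPDFReal]
    rw [← ENNReal.ofReal_mul (by positivity), ← ENNReal.ofReal_mul (by positivity), hv]
    congr 1
    have h1 : √(2 * Real.pi * ((1 / 2 : NNReal) : ℝ)) = √Real.pi := by
      congr 1; push_cast; ring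
    have h2 : √(2 * Real.pi * (1 / (2 * (1 + s)))) = √Real.pi / √(1 + s) := by
      rw [← Real.sqrt_div Real.pi_pos.le]; congr 1; field_simp
    have hq : √(1 + s) ≠ 0 := (Real.sqrt_pos.2 hs).ne'
    have hp : √Real.pi ≠ 0 := (Real.sqrt_pos.2 Real.pi_pos).ne'
    rw [h1, h2, mul_assoc, ← Real.exp_add, mul_mul_mul_comm, ← Real.exp_add]
    congr 1
    · field_simp
    · congr 1
      push_cast
      field_simp
      ring
  simp_rw [key]
  rw [lintegral_const_mul _ (measurable_gaussianPDF _ _), lintegral_gaussianPDF_eq_one _ hv0,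
    mul_one]

theorem measurable_complex_mk : Measurable (fun p : ℝ × ℝ => (⟨p.1, p.2⟩ : ℂ)) :=
  Complex.measurableEquivRealProd.symm.measurable

instance isProbabilityMeasure_stdComplexGaussian : IsProbabilityMeasure stdComplexGaussian :=
  Measure.isProbabilityMeasure_map measurable_complex_mk.aemeasurable

/-- The Gaussian integral `𝔼 exp (2 Re (b z̄) - s |z|²) = exp (|b|² / (1 + s)) / (1 + s)`. -/
theorem lintegral_exp_quadratic_stdComplexGaussian (b : ℂ) (s : ℝ) (hs : 0 < 1 + s) :
    ∫⁻ z, ENNReal.ofReal (Real.exp (2 * (b * star z).re - s * ‖z‖ ^ 2)) ∂stdComplexGaussian =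
      ENNReal.ofReal ((1 + s)⁻¹ * Real.exp (‖b‖ ^ 2 / (1 + s))) := by
  rw [stdComplexGaussian, lintegral_map (by fun_prop) measurable_complex_mk]
  have key : ∀ p : ℝ × ℝ, ENNReal.ofReal (Real.exp
      (2 * (b * star (⟨p.1, p.2⟩ : ℂ)).re - s * ‖(⟨p.1, p.2⟩ : ℂ)‖ ^ 2)) =
      ENNReal.ofReal (Real.exp (2 * b.re * p.1 - s * p.1 ^ 2)) *
      ENNReal.ofReal (Real.exp (2 * b.im * p.2 - s * p.2 ^ 2)) := by
    intro p
    rw [← ENNReal.ofReal_mul (by positivity), ← Real.exp_add, Complex.sq_norm,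
      Complex.normSq_apply]
    congr 2
    simp [Complex.mul_re]
    ring
  simp_rw [key]
  rw [lintegral_prod_mul (f := fun x => ENNReal.ofReal (Real.exp (2 * b.re * x - s * x ^ 2)))
    (g := fun x => ENNReal.ofReal (Real.exp (2 * b.im * x - s * x ^ 2))) (by fun_prop) (by fun_prop),
    lintegral_exp_quadratic_gaussianReal _ _ hs,
    lintegral_exp_quadratic_gaussianReal _ _ hs, ← ENNReal.ofReal_mul (by positivity)]
  congr 1
  rw [mul_mul_mul_comm, ← Real.exp_add, ← mul_inv, Real.mul_self_sqrt hs.le, Complex.sq_norm,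
    Complex.normSq_apply]
  congr 2
  ring

theorem lintegral_pi_prod {ι E : Type*} [Fintype ι] [MeasurableSpace E]
    (γ : Measure E) [IsProbabilityMeasure γ] (f : ι → E → ENNReal) (hf : ∀ i, Measurable (f i)) :
    ∫⁻ x, ∏ i, f i (x i) ∂Measure.pi (fun _ : ι => γ) = ∏ i, ∫⁻ z, f i z ∂γ := by
  have hind := iIndepFun_pi (μ := fun _ : ι => γ) (X := f) (fun i => (hf i).aemeasurable)
  have h := lintegral_prod_eq_prod_lintegral_of_indepFun Finset.univ _ hind
    (fun i => (hf i).comp (measurable_pi_apply i))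
  rw [h]
  refine Finset.prod_congr rfl fun i _ => ?_
  exact (measurePreserving_eval (fun _ : ι => γ) i).lintegral_comp (hf i)

-- Nets and the operator norm

/-- A `1 / 2`-net of the unit sphere, of the cardinality given by the volume argument. -/
theorem exists_half_net_sphere (E : Type*) [NormedAddCommGroup E] [NormedSpace ℝ E]
    [FiniteDimensional ℝ E] :
    ∃ N : Finset E, N.card ≤ 5 ^ Module.finrank ℝ E ∧ (∀ y ∈ N, ‖y‖ = 1) ∧
      ∀ x : E, ‖x‖ = 1 → ∃ y ∈ N, ‖x - y‖ ≤ 1 / 2 := by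
  classical
  let P : ℕ → Prop := fun n => ∃ s : Finset E, s.card = n ∧ (∀ y ∈ s, ‖y‖ = 1) ∧
    ∀ x ∈ s, ∀ y ∈ s, x ≠ y → 1 / 2 ≤ ‖x - y‖
  have hbound : ∀ n, P n → n ≤ 5 ^ Module.finrank ℝ E := by
    rintro n ⟨s, rfl, h1, h2⟩
    -- Doubling turns separation `1 / 2` on the unit sphere into separation `1` in the ball of
    -- radius `2`, the normalization of the Besicovitch bound.
    have hinj : Function.Injective (fun x : E => (2 : ℝ) • x) :=
      smul_right_injective E two_ne_zero
    rw [← Finset.card_image_of_injective s hinj]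
    refine Besicovitch.card_le_of_separated _ ?_ ?_
    · intro c hc
      obtain ⟨x, hx, rfl⟩ := Finset.mem_image.1 hc
      simp [norm_smul, h1 x hx]
    · intro c hc e he hne
      obtain ⟨x, hx, rfl⟩ := Finset.mem_image.1 hc
      obtain ⟨y, hy, rfl⟩ := Finset.mem_image.1 he
      have := h2 x hx y hy (fun h => hne (by rw [h]))
      simp only [← smul_sub, norm_smul, Real.norm_ofNat]
      linarith
  have h0 : P 0 := ⟨∅, by simp⟩
  -- A separated set of maximal cardinality is a net: a point far from it could be added.
  obtain ⟨N, hcard, h1, h2⟩ : P (Nat.findGreatest P (5 ^ Module.finrank ℝ E)) :=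
    Nat.findGreatest_spec (Nat.zero_le _) h0
  refine ⟨N, hcard ▸ Nat.findGreatest_le _, h1, fun x hx => ?_⟩
  by_contra! hfar
  have hxN : x ∉ N := fun h => by have := hfar x h; norm_num at this
  have hP : P (N.card + 1) := by
    refine ⟨insert x N, Finset.card_insert_of_notMem hxN, ?_, ?_⟩
    · simpa [hx] using h1
    · intro a ha b hb hne
      rcases Finset.mem_insert.1 ha with rfl | haN <;>
        rcases Finset.mem_insert.1 hb with rfl | hbN
      · exact absurd rfl hne
      · exact (hfar b hbN).le
      · rw [norm_sub_rev]; exact (hfar a haN).le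
      · exact h2 a haN b hbN hne
  have := Nat.le_findGreatest (hbound _ hP) hP
  omega

/-- Near a maximizing unit vector, `‖A y‖` is within a second-order error of the operator norm. -/
theorem exists_norm_apply_ge {E : Type*} [NormedAddCommGroup E] [InnerProductSpace ℂ E]
    [FiniteDimensional ℂ E] [Nontrivial E] (A : E →L[ℂ] E) :
    ∃ x : E, ‖x‖ = 1 ∧ ∀ y : E, ‖y‖ = 1 → ‖x - y‖ ≤ 1 / 2 → 7 / 8 * ‖A‖ ≤ ‖A y‖ := by
  have : ProperSpace E := FiniteDimensional.proper ℂ E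
  have : CompleteSpace E := FiniteDimensional.complete ℂ E
  let _ : NormedSpace ℝ E := NormedSpace.restrictScalars ℝ ℂ E
  obtain ⟨x, hx, hmax⟩ := (isCompact_sphere (0 : E) 1).exists_isMaxOn
    (NormedSpace.sphere_nonempty.2 zero_le_one) (f := fun x => ‖A x‖) (by fun_prop)
  have hx1 : ‖x‖ = 1 := by simpa using hx
  have hAx : ‖A x‖ = ‖A‖ := by
    refine le_antisymm (by simpa [hx1] using A.le_opNorm x)
      (A.opNorm_le_of_unit_norm (norm_nonneg _) fun z hz => hmax (by simpa using hz))
  refine ⟨x, hx1, fun y hy hxy => ?_⟩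
  set s := ‖A‖ with hs
  have hs0 : 0 ≤ s := norm_nonneg A
  rcases hs0.eq_or_lt with h0 | hpos
  · rw [← h0, mul_zero]; exact norm_nonneg _
  set B := ContinuousLinearMap.adjoint A
  have hB : ‖B‖ = s := by simp [B, hs]
  -- The maximizer is a top right singular vector: expanding `‖A†A x - s² x‖²` gives at most `s⁴ -
  -- 2s⁴ + s⁴ = 0`. Hence `⟪A x, A y⟫ = s² ⟪x, y⟫`, and `Re ⟪x, y⟫ = 1 - ‖x - y‖² / 2 ≥ 7/8`. The
  -- triangle inequality would give only `1/2`, too weak for the final constants.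
  have heig : B (A x) = ((s ^ 2 : ℝ) : ℂ) • x := by
    rw [← sub_eq_zero, ← norm_eq_zero, ← sq_eq_zero_iff]
    refine le_antisymm ?_ (sq_nonneg _)
    rw [@norm_sub_sq ℂ, inner_smul_right, ContinuousLinearMap.adjoint_inner_left,
      inner_self_eq_norm_sq_to_K, hAx, norm_smul, hx1]
    have h1 : ‖B (A x)‖ ≤ s ^ 2 := by
      have := B.le_opNorm (A x)
      rw [hB, hAx] at this
      nlinarith
    have h2 : ‖B (A x)‖ ^ 2 ≤ (s ^ 2) ^ 2 := pow_le_pow_left₀ (norm_nonneg _) h1 2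
    have h3 : RCLike.re (((s ^ 2 : ℝ) : ℂ) * ((s : ℂ)) ^ 2) = s ^ 2 * s ^ 2 := by
      rw [← Complex.ofReal_pow, ← Complex.ofReal_mul]; rfl
    have h4 : ‖((s ^ 2 : ℝ) : ℂ)‖ = s ^ 2 := by
      rw [Complex.norm_real, Real.norm_of_nonneg (sq_nonneg _)]
    simp only [Complex.coe_algebraMap] at *
    rw [h4]
    erw [h3]
    nlinarith
  have hin : inner ℂ (A x) (A y) = ((s ^ 2 : ℝ) : ℂ) * inner ℂ x y := by
    rw [← ContinuousLinearMap.adjoint_inner_left, heig, inner_smul_left, Complex.conj_ofReal]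
  have hre : 7 / 8 ≤ ‖inner ℂ x y‖ := by
    refine le_trans ?_ (Complex.re_le_norm _)
    have h := @norm_sub_sq ℂ _ _ _ _ x y
    rw [hx1, hy] at h
    have h' : ‖x - y‖ ^ 2 ≤ (1 / 2) ^ 2 := pow_le_pow_left₀ (norm_nonneg _) hxy 2
    simp only [RCLike.re_to_complex] at h
    linarith
  have hcs := norm_inner_le_norm (𝕜 := ℂ) (A x) (A y)
  rw [hin, hAx, norm_mul, Complex.norm_real, Real.norm_of_nonneg (sq_nonneg _)] at hcs
  have : s * (7 / 8 * s) ≤ s * ‖A y‖ := by nlinarith [sq_nonneg s]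
  exact le_of_mul_le_mul_left this hpos

theorem schattenTwoNorm_nonneg {d : ℕ} (X : Matrix (Fin d) (Fin d) ℂ) : 0 ≤ schattenTwoNorm X :=
  Real.sqrt_nonneg _

theorem operatorNorm_frobeniusNormalize {d : ℕ} (X : Matrix (Fin d) (Fin d) ℂ) :
    operatorNorm (frobeniusNormalize X) =
      (schattenTwoNorm X)⁻¹ * ‖Matrix.toEuclideanCLM (n := Fin d) (𝕜 := ℂ) X‖ := by
  rw [operatorNorm, frobeniusNormalize, map_smul, norm_smul, norm_inv, Complex.norm_real,
    Real.norm_of_nonneg (schattenTwoNorm_nonneg X)]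

theorem schattenTwoNorm_sq {d : ℕ} (X : Matrix (Fin d) (Fin d) ℂ) :
    schattenTwoNorm X ^ 2 = ∑ p : Fin d × Fin d, ‖X p.1 p.2‖ ^ 2 := by
  have h : (X * Xᴴ).trace.re = ∑ p : Fin d × Fin d, ‖X p.1 p.2‖ ^ 2 := by
    rw [Fintype.sum_prod_type]
    simp only [Matrix.trace, Matrix.diag, Matrix.mul_apply, Matrix.conjTranspose_apply,
      Complex.re_sum]
    refine Finset.sum_congr rfl fun i _ => Finset.sum_congr rfl fun j _ => ?_
    rw [Complex.sq_norm, Complex.normSq_apply]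
    simp
  rw [schattenTwoNorm, h, Real.sq_sqrt (by positivity)]

theorem norm_toEuclideanCLM_apply_sq {d : ℕ} (X : Matrix (Fin d) (Fin d) ℂ)
    (y : EuclideanSpace ℂ (Fin d)) :
    ‖Matrix.toEuclideanCLM (n := Fin d) (𝕜 := ℂ) X y‖ ^ 2 = ∑ i, ‖∑ j, X i j * y j‖ ^ 2 := by
  rw [EuclideanSpace.norm_sq_eq]
  rfl

/-- If the normalized matrix has large operator norm, some net point sees a large part of the
Frobenius norm. -/
theorem exists_mem_net_of_lt_operatorNorm {d : ℕ} [NeZero d] {N : Finset (EuclideanSpace ℂ (Fin d))}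
    (hN1 : ∀ y ∈ N, ‖y‖ = 1) (hN : ∀ x : EuclideanSpace ℂ (Fin d), ‖x‖ = 1 →
      ∃ y ∈ N, ‖x - y‖ ≤ 1 / 2) (X : Matrix (Fin d) (Fin d) ℂ) {T : ℝ} (hT : 0 ≤ T)
    (h : T < operatorNorm (frobeniusNormalize X) ^ 2) :
    ∃ y ∈ N, 49 / 64 * T * ∑ p : Fin d × Fin d, ‖X p.1 p.2‖ ^ 2 ≤
      ∑ i, ‖∑ j, X i j * y j‖ ^ 2 := by
  set A := Matrix.toEuclideanCLM (n := Fin d) (𝕜 := ℂ) X with hA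
  have hop := operatorNorm_frobeniusNormalize X
  rw [← hA] at hop
  obtain ⟨x, hx, hxA⟩ := exists_norm_apply_ge A
  obtain ⟨y, hy, hxy⟩ := hN x hx
  refine ⟨y, hy, ?_⟩
  have hAy := hxA y (hN1 y hy) hxy
  rw [← schattenTwoNorm_sq, ← norm_toEuclideanCLM_apply_sq]
  have hF : 0 < schattenTwoNorm X := by
    refine (schattenTwoNorm_nonneg X).lt_of_ne fun h0 => ?_
    rw [hop, ← h0] at h
    simp at h
    linarith
  rw [hop, mul_pow, inv_pow, inv_mul_eq_div, lt_div_iff₀ (by positivity)] at h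
  have : (7 / 8 * ‖A‖) ^ 2 ≤ ‖A y‖ ^ 2 := pow_le_pow_left₀ (by positivity) hAy 2
  nlinarith

-- Exponential moment and tail for a fixed vector

/-- The exponential moment of `θ ‖X y‖² - s ‖X‖₂²` for a Ginibre matrix `X` and a unit vector `y`. -/
theorem lintegral_exp_norm_mulVec_sq_sub {d : ℕ} (y : EuclideanSpace ℂ (Fin d)) (hy : ‖y‖ = 1)
    (θ s : ℝ) (hθ : 0 ≤ θ) (hs : 0 ≤ s) (hθs : θ < 1 + s) :
    ∫⁻ x : Fin d × Fin d → ℂ, ENNReal.ofReal (Real.exp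
        (θ * ∑ i, ‖∑ j, x (i, j) * y j‖ ^ 2 - s * ∑ p, ‖x p‖ ^ 2))
        ∂Measure.pi (fun _ => stdComplexGaussian) =
      ENNReal.ofReal (((1 + s)⁻¹ ^ d * (1 - θ / (1 + s))⁻¹) ^ d) := by
  have hs1 : 0 < 1 + s := by linarith
  have hfrac : 0 < 1 - θ / (1 + s) := by rw [sub_pos, div_lt_one hs1]; exact hθs
  let b : Fin d → ℂ → ℂ := fun j w => √θ * star (y j) * w
  let h : (Fin d → ℂ) → Fin d × Fin d → ℂ → ENNReal := fun w p z =>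
    ENNReal.ofReal (Real.exp (2 * (b p.2 (w p.1) * star z).re - s * ‖z‖ ^ 2))
  -- Linearization by an auxiliary Gaussian vector `w`: `exp |a|² = 𝔼 exp (2 Re (a w̄))`. After
  -- Tonelli, the integrand factors over the entries of `x`.
  have hlin : ∀ x : Fin d × Fin d → ℂ, ENNReal.ofReal (Real.exp
      (θ * ∑ i, ‖∑ j, x (i, j) * y j‖ ^ 2 - s * ∑ p, ‖x p‖ ^ 2)) =
      ∫⁻ w : Fin d → ℂ, ∏ p, h w p (x p) ∂Measure.pi (fun _ => stdComplexGaussian) := by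
    intro x
    let a : Fin d → ℂ := fun i => √θ * ∑ j, x (i, j) * y j
    have hprod : ∀ w : Fin d → ℂ, ∏ p, h w p (x p) =
        ENNReal.ofReal (Real.exp (-(s * ∑ p, ‖x p‖ ^ 2))) *
        ∏ i, ENNReal.ofReal (Real.exp (2 * (a i * star (w i)).re - 0 * ‖w i‖ ^ 2)) := by
      intro w
      simp only [h]
      rw [← ENNReal.ofReal_prod_of_nonneg (fun _ _ => (Real.exp_pos _).le),
        ← ENNReal.ofReal_prod_of_nonneg (fun _ _ => (Real.exp_pos _).le),
        ← ENNReal.ofReal_mul (Real.exp_pos _).le, ← Real.exp_sum, ← Real.exp_sum, ← Real.exp_add]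
      congr 2
      rw [Finset.sum_sub_distrib, ← Finset.mul_sum _ (fun p => ‖x p‖ ^ 2), Fintype.sum_prod_type,
        sub_eq_neg_add]
      congr 1
      refine Finset.sum_congr rfl fun i _ => ?_
      rw [← Finset.mul_sum, ← Complex.re_sum Finset.univ, zero_mul, sub_zero]
      congr 1
      rw [← Complex.conj_re (a i * star (w i))]
      congr 1
      simp only [a, b, map_mul, map_sum, Finset.mul_sum, Finset.sum_mul, Complex.conj_ofReal,
        ← starRingEnd_apply, Complex.conj_conj]
      exact Finset.sum_congr rfl fun j _ => by ring
    simp_rw [hprod]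
    rw [lintegral_const_mul _ (by fun_prop), lintegral_pi_prod stdComplexGaussian
      (fun i z => ENNReal.ofReal (Real.exp (2 * (a i * star z).re - 0 * ‖z‖ ^ 2)))
      (fun i => by fun_prop)]
    have : ∀ i, ‖a i‖ ^ 2 = θ * ‖∑ j, x (i, j) * y j‖ ^ 2 := by
      intro i
      simp only [a]
      rw [norm_mul, mul_pow, Complex.norm_real, Real.norm_of_nonneg (Real.sqrt_nonneg _),
        Real.sq_sqrt hθ]
    simp_rw [lintegral_exp_quadratic_stdComplexGaussian _ 0 (by norm_num : (0 : ℝ) < 1 + 0), this,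
      add_zero, inv_one, one_mul, div_one]
    rw [← ENNReal.ofReal_prod_of_nonneg (fun _ _ => (Real.exp_pos _).le), ← Real.exp_sum,
      ← ENNReal.ofReal_mul (Real.exp_pos _).le, ← Real.exp_add, ← Finset.mul_sum]
    congr 2
    ring
  have hy2 : ∑ j, ‖y j‖ ^ 2 = 1 := by rw [← EuclideanSpace.norm_sq_eq, hy, one_pow]
  have hb : ∀ w j, ‖b j w‖ ^ 2 = θ * ‖y j‖ ^ 2 * ‖w‖ ^ 2 := by
    intro w j
    simp only [b]
    rw [norm_mul, norm_mul, mul_pow, mul_pow, Complex.norm_real,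
      Real.norm_of_nonneg (Real.sqrt_nonneg _), Real.sq_sqrt hθ, norm_star]
  -- The right side is put in the form of the same quadratic integral, with `b = 0` and a negative
  -- `s`, for the integration over `w`.
  have hinner : ∀ w : Fin d → ℂ, ∫⁻ x, ∏ p, h w p (x p)
      ∂Measure.pi (fun _ : Fin d × Fin d => stdComplexGaussian) =
      ∏ i, ENNReal.ofReal ((1 + s)⁻¹ ^ d) * ENNReal.ofReal (Real.exp
        (2 * ((0 : ℂ) * star (w i)).re - (-(θ / (1 + s))) * ‖w i‖ ^ 2)) := by
    intro w
    rw [lintegral_pi_prod stdComplexGaussian (h w) (fun p => by simp only [h]; fun_prop)]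
    simp only [h, lintegral_exp_quadratic_stdComplexGaussian _ s hs1, hb]
    rw [Fintype.prod_prod_type]
    refine Finset.prod_congr rfl fun i _ => ?_
    rw [← ENNReal.ofReal_prod_of_nonneg (fun _ _ => by positivity),
      ← ENNReal.ofReal_mul (by positivity), Finset.prod_mul_distrib, ← Real.exp_sum,
      Finset.prod_const, Finset.card_univ, Fintype.card_fin]
    congr 3
    dsimp only
    rw [← Finset.sum_div, ← Finset.sum_mul, ← Finset.mul_sum, hy2]
    simp
    ring
  simp_rw [hlin]
  rw [lintegral_lintegral_swap]
  · simp_rw [hinner]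
    rw [lintegral_pi_prod stdComplexGaussian (fun _ z => ENNReal.ofReal ((1 + s)⁻¹ ^ d) *
      ENNReal.ofReal (Real.exp (2 * ((0 : ℂ) * star z).re - (-(θ / (1 + s))) * ‖z‖ ^ 2)))
      (fun _ => by fun_prop)]
    rw [lintegral_const_mul _ (by fun_prop), lintegral_exp_quadratic_stdComplexGaussian _ _
      (by linarith), Finset.prod_const, Finset.card_univ, Fintype.card_fin,
      ← ENNReal.ofReal_mul (by positivity), ← ENNReal.ofReal_pow (by
        have : 0 < 1 + -(θ / (1 + s)) := by linarith
        positivity)]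
    simp [sub_eq_add_neg]
  · simp only [h, b]
    fun_prop

/-- Markov's inequality for the exponential moment with `θ = 1/2`, `s = t/2`; this choice keeps `(1
- θ / (1 + s))⁻¹` at most `2`. -/
theorem IsComplexGinibre.measure_le {Ω : Type*} [MeasurableSpace Ω] {μ : Measure Ω}
    [IsProbabilityMeasure μ] {d : ℕ} {G : Ω → Matrix (Fin d) (Fin d) ℂ}
    (hG : IsComplexGinibre G μ) (y : EuclideanSpace ℂ (Fin d)) (hy : ‖y‖ = 1) (t : ℝ)
    (ht : 0 ≤ t) :
    μ {ω | t * ∑ p : Fin d × Fin d, ‖G ω p.1 p.2‖ ^ 2 ≤ ∑ i, ‖∑ j, G ω i j * y j‖ ^ 2} ≤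
      ENNReal.ofReal (((1 + t / 2)⁻¹ ^ d * 2) ^ d) := by
  have hlaw := hG.indep.hasLaw_pi (fun p : Fin d × Fin d => hG.hasLaw p.1 p.2)
  let F : (Fin d × Fin d → ℂ) → ENNReal := fun x => ENNReal.ofReal (Real.exp
    ((1 / 2) * ∑ i, ‖∑ j, x (i, j) * y j‖ ^ 2 - (t / 2) * ∑ p, ‖x p‖ ^ 2))
  have hF : Measurable F := by simp only [F]; fun_prop
  calc _ ≤ μ {ω | 1 ≤ F (fun p => G ω p.1 p.2)} := by
        refine measure_mono fun ω hω => ?_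
        simp only [Set.mem_ofPred_eq, F] at hω ⊢
        rw [ENNReal.one_le_ofReal, Real.one_le_exp_iff]
        linarith
    _ ≤ (∫⁻ ω, F (fun p => G ω p.1 p.2) ∂μ) / 1 :=
        meas_ge_le_lintegral_div (hF.comp_aemeasurable hlaw.aemeasurable) one_ne_zero
          ENNReal.one_ne_top
    _ = ENNReal.ofReal (((1 + t / 2)⁻¹ ^ d * (1 - (1 / 2) / (1 + t / 2))⁻¹) ^ d) := by
        rw [div_one, hlaw.lintegral_comp hF.aemeasurable]
        exact lintegral_exp_norm_mulVec_sq_sub y hy (1 / 2) (t / 2) (by norm_num) (by linarith)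
          (by linarith)
    _ ≤ _ := by
        have h1 : 1 / 2 / (1 + t / 2) ≤ 1 / 2 := by
          rw [div_le_iff₀ (by linarith)]; linarith
        have h2 : (1 - (1 / 2) / (1 + t / 2))⁻¹ ≤ 2 := by
          rw [inv_le_comm₀ (by linarith) two_pos]; linarith
        have h3 : 0 ≤ (1 - (1 / 2) / (1 + t / 2))⁻¹ := inv_nonneg.2 (by linarith)
        refine ENNReal.ofReal_le_ofReal (pow_le_pow_left₀ (by positivity) ?_ d)
        exact mul_le_mul_of_nonneg_left h2 (by positivity)

-- Union bound

theorem operatorNorm_frobeniusNormalize_le_one {d : ℕ} (X : Matrix (Fin d) (Fin d) ℂ) :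
    operatorNorm (frobeniusNormalize X) ^ 2 ≤ 1 := by
  have hle : ‖Matrix.toEuclideanCLM (n := Fin d) (𝕜 := ℂ) X‖ ≤ schattenTwoNorm X := by
    refine ContinuousLinearMap.opNorm_le_bound _ (schattenTwoNorm_nonneg X) fun y => ?_
    refine le_of_sq_le_sq ?_ (mul_nonneg (schattenTwoNorm_nonneg X) (norm_nonneg _))
    rw [mul_pow, schattenTwoNorm_sq, norm_toEuclideanCLM_apply_sq, Fintype.sum_prod_type,
      Finset.sum_mul, EuclideanSpace.norm_sq_eq]
    refine Finset.sum_le_sum fun i _ => ?_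
    calc _ ≤ (∑ j, ‖X i j‖ * ‖y j‖) ^ 2 := by
          refine pow_le_pow_left₀ (norm_nonneg _) ((norm_sum_le _ _).trans_eq ?_) 2
          simp
      _ ≤ _ := Finset.sum_mul_sq_le_sq_mul_sq _ _ _
  rw [operatorNorm_frobeniusNormalize]
  refine pow_le_one₀ (mul_nonneg (inv_nonneg.2 (schattenTwoNorm_nonneg X)) (norm_nonneg _)) ?_
  exact inv_mul_le_one_of_le₀ hle (schattenTwoNorm_nonneg X)

theorem net_mul_tail_le {d : ℕ} (hd : 0 < d) {T δ : ℝ} (hδ : δ ∈ Set.Ioo (0 : ℝ) 1)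
    (hT : T = 16 / (d : ℝ) + 8 * Real.log (2 / δ) / (d : ℝ) ^ 2) (hT1 : T ≤ 1) :
    (5 : ℝ) ^ (2 * d) * ((1 + 49 / 64 * T / 2)⁻¹ ^ d * 2) ^ d ≤ δ := by
  have hd' : (0 : ℝ) < d := by exact_mod_cast hd
  obtain ⟨hδ0, hδ1⟩ := hδ
  set l := Real.log (2 / δ) with hl
  have hl0 : 0 ≤ l := Real.log_nonneg (by rw [le_div_iff₀ hδ0]; linarith)
  have hTd : T * (d : ℝ) ^ 2 = 16 * d + 8 * l := by rw [hT]; field_simp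
  have hT0 : 0 ≤ T := by rw [hT]; positivity
  set u := 49 / 64 * T / 2 with hu
  have hu0 : 0 ≤ u := by positivity
  -- From `log (1 + u) ≥ 2u / (u + 2)`; `T ≤ 1` bounds the denominator.
  have hlog : 3 / 10 * T ≤ Real.log (1 + u) := by
    refine le_trans ?_ (Real.le_log_one_add_of_nonneg hu0)
    rw [le_div_iff₀ (by linarith), hu]
    nlinarith
  have hexp : Real.exp (3 / 10 * T) ≤ 1 + u :=
    (Real.le_log_iff_exp_le (by linarith)).1 hlog
  have hinv : (1 + u)⁻¹ ≤ Real.exp (-(3 / 10 * T)) := by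
    rw [Real.exp_neg]; exact inv_anti₀ (Real.exp_pos _) hexp
  have h50 : (50 : ℝ) ≤ Real.exp 4 := by
    have h1 := Real.exp_one_gt_d9
    have h2 : Real.exp 4 = Real.exp 1 ^ 4 := by rw [← Real.exp_nat_mul]; norm_num
    rw [h2]
    calc (50 : ℝ) ≤ 2.7 ^ 4 := by norm_num
      _ ≤ _ := pow_le_pow_left₀ (by norm_num) (by linarith) 4
  calc (5 : ℝ) ^ (2 * d) * ((1 + u)⁻¹ ^ d * 2) ^ d
      = 50 ^ d * ((1 + u)⁻¹) ^ (d * d) := by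
        rw [mul_pow, ← pow_mul, pow_mul, mul_left_comm, mul_comm, ← mul_pow]; norm_num
    _ ≤ Real.exp 4 ^ d * Real.exp (-(3 / 10 * T)) ^ (d * d) := by
        gcongr
    _ = Real.exp (4 * d - 3 / 10 * (T * (d : ℝ) ^ 2)) := by
        rw [← Real.exp_nat_mul, ← Real.exp_nat_mul, ← Real.exp_add]
        congr 1; push_cast; ring
    -- The exponent is `4d - 4.8d - 2.4l`.
    _ ≤ Real.exp (-l) := by
        rw [Real.exp_le_exp, hTd]; linarith
    _ = δ / 2 := by
        rw [Real.exp_neg, hl, Real.exp_log (by positivity), inv_div]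
    _ ≤ δ := by linarith

theorem proposition1 {Ω : Type*} [MeasurableSpace Ω] (μ : Measure Ω) [IsProbabilityMeasure μ]
    (d : ℕ) (hd : 2 ≤ d) (G : Ω → Matrix (Fin d) (Fin d) ℂ) (hG : IsComplexGinibre G μ)
    (δ : ℝ) (hδ : δ ∈ Set.Ioo (0 : ℝ) 1) :
    1 - δ ≤ μ.real {ω | operatorNorm (frobeniusNormalize (G ω)) ^ 2 ≤
      16 / (d : ℝ) + 8 * Real.log (2 / δ) / (d : ℝ) ^ 2} := by
  have : NeZero d := ⟨by omega⟩
  set T := 16 / (d : ℝ) + 8 * Real.log (2 / δ) / (d : ℝ) ^ 2 with hT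
  set S := {ω | operatorNorm (frobeniusNormalize (G ω)) ^ 2 ≤ T} with hS
  rcases le_total 1 T with hT1 | hT1
  · have : S = Set.univ :=
      Set.eq_univ_of_forall fun ω => (operatorNorm_frobeniusNormalize_le_one _).trans hT1
    rw [this, probReal_univ]
    linarith [hδ.1]
  have hT0 : 0 ≤ T := by
    have : 0 ≤ Real.log (2 / δ) :=
      Real.log_nonneg (by rw [le_div_iff₀ hδ.1]; linarith [hδ.2])
    positivity
  let _ : NormedSpace ℝ (EuclideanSpace ℂ (Fin d)) := NormedSpace.complexToReal
  obtain ⟨N, hcard, hN1, hN⟩ := exists_half_net_sphere (EuclideanSpace ℂ (Fin d))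
  rw [finrank_real_of_complex, finrank_euclideanSpace_fin] at hcard
  have hbad : μ Sᶜ ≤ ENNReal.ofReal δ := by
    calc μ Sᶜ ≤ μ (⋃ y ∈ N, {ω | 49 / 64 * T * ∑ p : Fin d × Fin d, ‖G ω p.1 p.2‖ ^ 2 ≤
            ∑ i, ‖∑ j, G ω i j * y j‖ ^ 2}) := by
          refine measure_mono fun ω hω => ?_
          simp only [hS, Set.mem_compl_iff, Set.mem_ofPred_eq, not_le] at hω
          obtain ⟨y, hy, h⟩ := exists_mem_net_of_lt_operatorNorm hN1 hN (G ω) hT0 hω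
          exact Set.mem_biUnion hy h
      _ ≤ ∑ y ∈ N, ENNReal.ofReal (((1 + 49 / 64 * T / 2)⁻¹ ^ d * 2) ^ d) :=
          (measure_biUnion_finset_le _ _).trans
            (Finset.sum_le_sum fun y hy => hG.measure_le y (hN1 y hy) _ (by positivity))
      _ = ENNReal.ofReal (N.card * ((1 + 49 / 64 * T / 2)⁻¹ ^ d * 2) ^ d) := by
          rw [Finset.sum_const, nsmul_eq_mul, ENNReal.ofReal_mul (by positivity),
            ENNReal.ofReal_natCast]
      _ ≤ ENNReal.ofReal δ := by
          refine ENNReal.ofReal_le_ofReal (le_trans ?_ (net_mul_tail_le (by omega) hδ hT hT1))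
          refine mul_le_mul_of_nonneg_right ?_ (by positivity)
          exact_mod_cast hcard
  have hreal : μ.real Sᶜ ≤ δ := ENNReal.toReal_le_of_le_ofReal hδ.1.le hbad
  have hone : 1 ≤ μ.real S + μ.real Sᶜ := by
    rw [← probReal_univ (μ := μ), ← Set.union_compl_self S]
    exact measureReal_union_le _ _
  linarith
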